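/- Let $X$ and $Y$ be real or complex Banach spaces (over the same field). An unconditional Schauder decomposition of a Banach space $X$ is a family $\{X_i\}_{i\in I}$ of closed linear subspaces, indexed by an arbitrary (possibly uncountable) set $I$, such that every $x\in X$ can be written in a unique way as an unconditionally convergent series $x=\sum_{i\in I}x_i$ with $x_i\in X_i$ for all $i\in I$; for finite $C\subseteq I$ put $P_C(x):=\sum_{i\in C}x_i$. It is finite-dimensional if every $X_i$ is finite-dimensional. For $1<p<\infty$ it has a disjoint lower $p$-estimate if there is a constant $c>0$ such that $$\Big(\sum_{k=1}^r\|P_{C_k}(x)\|^p\Big)^{1/p}\le c\,\|x\|$$ for every finite collection $C_1,\dots,C_r$ of pairwise disjoint finite subsets of $I$ and every $x\in X$. The projective tensor product $X\widehat\otimes_\pi Y$ is the completion of the algebraic tensor product $X\otimes Y$ in the norm $$\|z\|=\sup\{|S(z)|: S \text{ a continuous bilinear functional on } X\times Y,\ \|S\|\le 1\},$$ where $S$ is identified with the linear functional on $X\otimes Y$ given by $x\otimes y\mapsto S(x,y)$. A Banach space is weakly sequentially complete if each of its weakly Cauchy sequences converges weakly. **Theorem.** Let $1<p,q<\infty$ with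 $\frac1p+\frac1q\ge 1$. Suppose that $X$ has a finite-dimensional unconditional Schauder decomposition $\{X_i\}_{i\in I}$ with a disjoint lower $p$-estimate, and that $Y$ has a finite-dimensional unconditional Schauder decomposition $\{Y_j\}_{j\in J}$ with a disjoint lower $q$-estimate. If $X$ and $Y$ are weakly sequentially complete, then so is $X\widehat\otimes_\pi Y$. -/

import Mathlib

open scoped TensorProduct

noncomputable section

/-- A normed space is weakly sequentially complete if every weakly Cauchy sequence converges
weakly. -/
def WeaklySequentiallyComplete (𝕜 : Type*) (Z : Type*) [RCLike 𝕜]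
    [NormedAddCommGroup Z] [NormedSpace 𝕜 Z] : Prop :=
  ∀ z : ℕ → Z, (∀ f : StrongDual 𝕜 Z, CauchySeq fun n => f (z n)) →
    ∃ a : Z, ∀ f : StrongDual 𝕜 Z,
      Filter.Tendsto (fun n => f (z n)) Filter.atTop (nhds (f a))

section Decomposition

variable {𝕜 : Type*} {X : Type*} {ι : Type*} [RCLike 𝕜] [NormedAddCommGroup X] [NormedSpace 𝕜 X]

/-- A family of closed subspaces `E i` is an unconditional Schauder decomposition if every vector
is, in a unique way, the sum of an unconditionally convergent series of vectors `u i ∈ E i`.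
(`HasSum` is convergence along the net of finite subsets of `ι`, that is, unconditional
convergence.) -/
structure IsUnconditionalSchauderDecomposition (E : ι → Submodule 𝕜 X) : Prop where
  isClosed : ∀ i, IsClosed (E i : Set X)
  existsUnique_expansion : ∀ x : X, ∃! u : ∀ i, E i, HasSum (fun i => (u i : X)) x

namespace IsUnconditionalSchauderDecomposition

variable {E : ι → Submodule 𝕜 X}

/-- The `i`-th component `P_i x ∈ E i` of `x`. -/
def component (h : IsUnconditionalSchauderDecomposition E) (i : ι) (x : X) : E i :=
  (h.existsUnique_expansion x).choose i

/-- `P_C x = ∑ i ∈ C, P_i x` for a finite set `C` of indices. -/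
def proj (h : IsUnconditionalSchauderDecomposition E) (C : Finset ι) (x : X) : X :=
  ∑ i ∈ C, (h.component i x : X)

/-- The disjoint lower `p`-estimate. -/
def HasDisjointLowerEstimate (h : IsUnconditionalSchauderDecomposition E) (p : ℝ) : Prop :=
  ∃ c : ℝ, 0 < c ∧ ∀ (r : ℕ) (C : Fin r → Finset ι),
    (∀ k l, k ≠ l → Disjoint (C k) (C l)) →
      ∀ x : X, (∑ k, ‖h.proj (C k) x‖ ^ p) ^ (1 / p) ≤ c * ‖x‖

end IsUnconditionalSchauderDecomposition

end Decomposition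

section Projective

variable (𝕜 : Type*) (X : Type*) (Y : Type*) [RCLike 𝕜] [NormedAddCommGroup X] [NormedSpace 𝕜 X]
  [NormedAddCommGroup Y] [NormedSpace 𝕜 Y]

/-- A copy of the algebraic tensor product `X ⊗ Y`, to carry the projective norm. -/
def AlgebraicProjectiveTensor : Type _ := X ⊗[𝕜] Y

namespace AlgebraicProjectiveTensor

instance : AddCommGroup (AlgebraicProjectiveTensor 𝕜 X Y) :=
  inferInstanceAs (AddCommGroup (X ⊗[𝕜] Y))

instance : Module 𝕜 (AlgebraicProjectiveTensor 𝕜 X Y) :=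
  inferInstanceAs (Module 𝕜 (X ⊗[𝕜] Y))

variable {𝕜 X Y}

/-- The elementary tensor `x ⊗ y`. -/
def tmul (x : X) (y : Y) : AlgebraicProjectiveTensor 𝕜 X Y := x ⊗ₜ[𝕜] y

/-- The linear functional on `X ⊗ Y` induced by a continuous bilinear functional `S` on `X × Y`:
it maps `x ⊗ y` to `S x y`. -/
def pairing (S : X →L[𝕜] Y →L[𝕜] 𝕜) : AlgebraicProjectiveTensor 𝕜 X Y →ₗ[𝕜] 𝕜 :=
  TensorProduct.lift ((ContinuousLinearMap.coeLM 𝕜).comp S.toLinearMap)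

theorem pairing_tmul (S : X →L[𝕜] Y →L[𝕜] 𝕜) (x : X) (y : Y) :
    pairing S (tmul x y) = S x y := by
  unfold pairing tmul
  exact TensorProduct.lift.tmul _ _

theorem exists_norm_pairing_le (z : AlgebraicProjectiveTensor 𝕜 X Y) :
    ∃ M : ℝ, ∀ S : X →L[𝕜] Y →L[𝕜] 𝕜, ‖S‖ ≤ 1 → ‖pairing S z‖ ≤ M := by
  induction z using TensorProduct.induction_on with
  | zero => exact ⟨0, fun S _ => by
      have h : pairing S (0 : AlgebraicProjectiveTensor 𝕜 X Y) = 0 := map_zero _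
      exact (congrArg norm h).trans_le (by simp)⟩
  | tmul x y =>
    refine ⟨‖x‖ * ‖y‖, fun S hS => ?_⟩
    refine (congrArg norm (pairing_tmul S x y)).trans_le ((S.le_opNorm₂ x y).trans ?_)
    rw [mul_assoc]
    exact mul_le_of_le_one_left (by positivity) hS
  | add a b ha hb =>
    obtain ⟨A, hA⟩ := ha
    obtain ⟨B, hB⟩ := hb
    refine ⟨A + B, fun S hS => ?_⟩
    have h : pairing S (a + b : AlgebraicProjectiveTensor 𝕜 X Y) = pairing S a + pairing S b :=
      map_add (pairing S) a b
    exact (congrArg norm h).trans_le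
      ((norm_add_le _ _).trans (add_le_add (hA S hS) (hB S hS)))

/-- The projective norm `‖z‖ = sup {|S z| : S a continuous bilinear functional, ‖S‖ ≤ 1}`. -/
def projNorm (z : AlgebraicProjectiveTensor 𝕜 X Y) : ℝ :=
  ⨆ S : {S : X →L[𝕜] Y →L[𝕜] 𝕜 // ‖S‖ ≤ 1}, ‖pairing S.1 z‖

instance : Nonempty {S : X →L[𝕜] Y →L[𝕜] 𝕜 // ‖S‖ ≤ 1} := 
  ⟨⟨0, (norm_zero (E := X →L[𝕜] Y →L[𝕜] 𝕜)).trans_le zero_le_one⟩⟩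

theorem norm_pairing_le_projNorm (z : AlgebraicProjectiveTensor 𝕜 X Y)
    (S : {S : X →L[𝕜] Y →L[𝕜] 𝕜 // ‖S‖ ≤ 1}) : ‖pairing S.1 z‖ ≤ projNorm z := by
  obtain ⟨M, hM⟩ := exists_norm_pairing_le z
  exact le_ciSup (f := fun S : {S : X →L[𝕜] Y →L[𝕜] 𝕜 // ‖S‖ ≤ 1} => ‖pairing S.1 z‖)
    ⟨M, by rintro _ ⟨T, rfl⟩; exact hM T.1 T.2⟩ S

variable (𝕜 X Y) in
/-- The projective norm bundled as a seminorm. -/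
def projSeminorm : Seminorm 𝕜 (AlgebraicProjectiveTensor 𝕜 X Y) :=
  Seminorm.ofSMulLE projNorm
    (by simp [projNorm])
    (fun a b => ciSup_le fun S => by
      rw [map_add]
      exact (norm_add_le _ _).trans
        (add_le_add (norm_pairing_le_projNorm a S) (norm_pairing_le_projNorm b S)))
    (fun c a => ciSup_le fun S => by
      rw [map_smul, norm_smul]
      exact mul_le_mul_of_nonneg_left (norm_pairing_le_projNorm a S) (norm_nonneg c))

instance : SeminormedAddCommGroup (AlgebraicProjectiveTensor 𝕜 X Y) :=
  (projSeminorm 𝕜 X Y).toAddGroupSeminorm.toSeminormedAddCommGroup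

instance : NormedSpace 𝕜 (AlgebraicProjectiveTensor 𝕜 X Y) where
  norm_smul_le c z := (map_smul_eq_mul (projSeminorm 𝕜 X Y) c z).le

end AlgebraicProjectiveTensor

/-- The projective tensor product: the completion of `X ⊗ Y` in the projective norm. -/
abbrev ProjectiveTensorProduct : Type _ :=
  UniformSpace.Completion (AlgebraicProjectiveTensor 𝕜 X Y)

end Projective

end

open Filter Topology

/-! ### Universal property of the projective tensor product, and tensor products of operators. -/

namespace ProjectiveTensorProduct

open AlgebraicProjectiveTensor

variable {𝕜 X Y W : Type*} [RCLike 𝕜] [NormedAddCommGroup X] [NormedSpace 𝕜 X]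
  [NormedAddCommGroup Y] [NormedSpace 𝕜 Y] [NormedAddCommGroup W] [NormedSpace 𝕜 W]

/-! For finite-rank projections P = P_A on X and Q = P_B on Y, split the identity of the tensor
product as P ⊗ 1 + (1 - P) ⊗ Q + (1 - P) ⊗ (1 - Q). The first two terms have a finite-rank factor,
so they factor through finitely many copies of Y or X and make weakly Cauchy sequences weakly
convergent (`exists_weakLimit_map_left`, `exists_weakLimit_map_right`). If A and B can be chosen so
that the third term is uniformly small along the sequence (`exists_forall_norm_tail_le`), uniform
approximation finishes the proof (`exists_weakLimit_of_approx`).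

For the tails, 1/p + 1/q ≥ 1 lets Hölder's inequality combine the two lower estimates into ∑
‖P_{A_k} x‖ ‖P_{B_k} y‖ ≤ cd ‖x‖ ‖y‖ for disjoint blocks, and duality extends this to an ℓ¹-estimate
for the operators P_{A_k} ⊗ P_{B_k} (`sum_norm_map_projL_le`). Were the tails not uniformly small, a
gliding hump would give disjoint blocks whose operators have norm above ε at terms of the sequence.
Phillips' lemma excludes this (`exists_norm_lt_of_weakCauchy`). -/

theorem norm_tmul_le (x : X) (y : Y) :
    ‖(tmul x y : AlgebraicProjectiveTensor 𝕜 X Y)‖ ≤ ‖x‖ * ‖y‖ := by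
  refine ciSup_le fun S => ?_
  rw [pairing_tmul]
  refine (S.1.le_opNorm₂ x y).trans ?_
  rw [mul_assoc]
  exact mul_le_of_le_one_left (by positivity) S.2

/-- The canonical continuous bilinear map into the completed tensor product. -/
noncomputable def mk : X →L[𝕜] Y →L[𝕜] ProjectiveTensorProduct 𝕜 X Y :=
  LinearMap.mkContinuous₂
    (LinearMap.mk₂ 𝕜 (fun x y => ((tmul x y : AlgebraicProjectiveTensor 𝕜 X Y) :
        ProjectiveTensorProduct 𝕜 X Y))
      (fun x x' y => by
        rw [← UniformSpace.Completion.coe_add]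
        exact congrArg _ (TensorProduct.add_tmul x x' y))
      (fun c x y => by
        rw [← UniformSpace.Completion.coe_smul]
        exact congrArg _ (TensorProduct.smul_tmul' c x y).symm)
      (fun x y y' => by
        rw [← UniformSpace.Completion.coe_add]
        exact congrArg _ (TensorProduct.tmul_add x y y'))
      (fun c x y => by
        rw [← UniformSpace.Completion.coe_smul]
        exact congrArg _ (TensorProduct.tmul_smul c x y)))
    1 (fun x y => by
      rw [one_mul, LinearMap.mk₂_apply, UniformSpace.Completion.norm_coe]
      exact norm_tmul_le x y)

theorem mk_apply (x : X) (y : Y) :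
    mk (𝕜 := 𝕜) x y = ((tmul x y : AlgebraicProjectiveTensor 𝕜 X Y) :
      ProjectiveTensorProduct 𝕜 X Y) := rfl

theorem norm_mk_le (x : X) (y : Y) : ‖mk (𝕜 := 𝕜) x y‖ ≤ ‖x‖ * ‖y‖ := by
  rw [mk_apply, UniformSpace.Completion.norm_coe]
  exact norm_tmul_le x y

theorem induction_closed {P : ProjectiveTensorProduct 𝕜 X Y → Prop}
    (hc : IsClosed {z | P z}) (hmk : ∀ x y, P (mk x y)) (hadd : ∀ z w, P z → P w → P (z + w))
    (z : ProjectiveTensorProduct 𝕜 X Y) : P z := by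
  induction z using UniformSpace.Completion.induction_on with
  | hp => exact hc
  | ih a =>
    induction a using TensorProduct.induction_on with
    | zero =>
      have h := hmk 0 0
      rw [map_zero] at h
      exact h
    | tmul x y => exact hmk x y
    | add a b ha hb =>
      have h := hadd _ _ ha hb
      erw [← UniformSpace.Completion.coe_add] at h
      exact h

theorem hom_ext {f g : ProjectiveTensorProduct 𝕜 X Y →L[𝕜] W}
    (h : ∀ x y, f (mk x y) = g (mk x y)) : f = g := by
  ext z
  induction z using induction_closed with
  | hc => exact isClosed_eq f.continuous g.continuous
  | hmk x y => exact h x y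
  | hadd z w hz hw => rw [map_add, map_add, hz, hw]

section Lift

/-- The linear map on the algebraic tensor product induced by a continuous bilinear map. -/
noncomputable def algebraicLift (β : X →L[𝕜] Y →L[𝕜] W) :
    AlgebraicProjectiveTensor 𝕜 X Y →ₗ[𝕜] W :=
  TensorProduct.lift ((ContinuousLinearMap.coeLM 𝕜).comp β.toLinearMap)

theorem algebraicLift_tmul (β : X →L[𝕜] Y →L[𝕜] W) (x : X) (y : Y) :
    algebraicLift β (tmul x y) = β x y :=
  TensorProduct.lift.tmul _ _

theorem pairing_comp (β : X →L[𝕜] Y →L[𝕜] W) (f : StrongDual 𝕜 W)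
    (z : AlgebraicProjectiveTensor 𝕜 X Y) :
    pairing ((ContinuousLinearMap.compL 𝕜 Y W 𝕜 f).comp β) z = f (algebraicLift β z) := by
  have : pairing ((ContinuousLinearMap.compL 𝕜 Y W 𝕜 f).comp β) =
      f.toLinearMap.comp (algebraicLift β) := TensorProduct.ext' fun x y => by
    refine (pairing_tmul _ x y).trans ?_
    exact congrArg f (algebraicLift_tmul β x y).symm
  rw [this]; rfl

/-- The form S/(C + δ) lies in the unit ball over which the projective norm is a supremum; δ > 0
allows for C = 0. -/
theorem norm_pairing_le {S : X →L[𝕜] Y →L[𝕜] 𝕜} {C : ℝ} (hC : 0 ≤ C)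
    (hS : ∀ x y, ‖S x y‖ ≤ C * (‖x‖ * ‖y‖)) (z : AlgebraicProjectiveTensor 𝕜 X Y) :
    ‖pairing S z‖ ≤ C * ‖z‖ := by
  refine le_of_forall_pos_le_add fun ε hε => ?_
  obtain ⟨δ, hδ, hδε⟩ : ∃ δ : ℝ, 0 < δ ∧ δ * ‖z‖ ≤ ε :=
    ⟨ε / (‖z‖ + 1), by positivity, by
      rw [div_mul_eq_mul_div, div_le_iff₀ (by positivity)]
      nlinarith [norm_nonneg z]⟩
  have hpos : 0 < C + δ := by linarith
  have hc : ‖((C + δ : ℝ) : 𝕜)⁻¹‖ = (C + δ)⁻¹ := by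
    rw [norm_inv, RCLike.norm_ofReal, abs_of_pos hpos]
  have h1 : ‖((C + δ : ℝ) : 𝕜)⁻¹ • S‖ ≤ 1 := by
    refine ContinuousLinearMap.opNorm_le_bound₂ _ zero_le_one fun x y => ?_
    simp only [smul_apply]
    rw [norm_smul, hc, inv_mul_le_iff₀ hpos]
    refine (hS x y).trans ?_
    rw [one_mul]
    exact mul_le_mul_of_nonneg_right (by linarith) (by positivity)
  have h2 := norm_pairing_le_projNorm z ⟨_, h1⟩
  have h3 : pairing (((C + δ : ℝ) : 𝕜)⁻¹ • S) = ((C + δ : ℝ) : 𝕜)⁻¹ • pairing S :=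
    TensorProduct.ext' fun x y => by
      refine (pairing_tmul _ x y).trans ?_
      exact congrArg (fun t => ((C + δ : ℝ) : 𝕜)⁻¹ • t) (pairing_tmul S x y).symm
  rw [h3, LinearMap.smul_apply, norm_smul, hc, inv_mul_le_iff₀ hpos] at h2
  calc ‖pairing S z‖ ≤ (C + δ) * ‖z‖ := h2
    _ = C * ‖z‖ + δ * ‖z‖ := by ring
    _ ≤ C * ‖z‖ + ε := by gcongr

/-- Composing β with a norming functional reduces this to scalar forms, the only ones that define
the norm. -/
theorem norm_algebraicLift_le {β : X →L[𝕜] Y →L[𝕜] W} {C : ℝ} (hC : 0 ≤ C)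
    (hβ : ∀ x y, ‖β x y‖ ≤ C * (‖x‖ * ‖y‖)) (z : AlgebraicProjectiveTensor 𝕜 X Y) :
    ‖algebraicLift β z‖ ≤ C * ‖z‖ := by
  obtain ⟨f, hf, hfz⟩ := exists_dual_vector'' 𝕜 (algebraicLift β z)
  have h := norm_pairing_le (S := (ContinuousLinearMap.compL 𝕜 Y W 𝕜 f).comp β) hC
    (fun x y => ((f.le_of_opNorm_le hf _).trans_eq (one_mul _)).trans (hβ x y)) z
  rwa [pairing_comp, hfz, RCLike.norm_ofReal, abs_norm] at h

theorem norm_algebraicLift_le_coe {β : X →L[𝕜] Y →L[𝕜] W} {C : ℝ} (hC : 0 ≤ C)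
    (hβ : ∀ x y, ‖β x y‖ ≤ C * (‖x‖ * ‖y‖)) (z : AlgebraicProjectiveTensor 𝕜 X Y) :
    ‖algebraicLift β z‖ ≤ C * ‖(UniformSpace.Completion.toComplL (𝕜 := 𝕜)
      (E := AlgebraicProjectiveTensor 𝕜 X Y)).toLinearMap z‖ :=
  (norm_algebraicLift_le hC hβ z).trans_eq
    (congrArg (C * ·) (UniformSpace.Completion.norm_coe z).symm)

variable [CompleteSpace W]

/-- The continuous linear map induced by a continuous bilinear map into a Banach space. -/
noncomputable def lift (β : X →L[𝕜] Y →L[𝕜] W) : ProjectiveTensorProduct 𝕜 X Y →L[𝕜] W :=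
  (algebraicLift β).extendOfNorm
    (UniformSpace.Completion.toComplL (𝕜 := 𝕜) (E := AlgebraicProjectiveTensor 𝕜 X Y)).toLinearMap

theorem lift_mk (β : X →L[𝕜] Y →L[𝕜] W) (x : X) (y : Y) : lift β (mk x y) = β x y :=
  (LinearMap.extendOfNorm_eq UniformSpace.Completion.denseRange_coe
    ⟨‖β‖, norm_algebraicLift_le_coe (ContinuousLinearMap.opNorm_nonneg β)
      fun x y => (β.le_opNorm₂ x y).trans_eq (mul_assoc _ _ _)⟩ (tmul x y)).trans
    (algebraicLift_tmul β x y)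

theorem norm_lift_le {β : X →L[𝕜] Y →L[𝕜] W} {C : ℝ} (hC : 0 ≤ C)
    (hβ : ∀ x y, ‖β x y‖ ≤ C * (‖x‖ * ‖y‖)) : ‖lift β‖ ≤ C :=
  LinearMap.opNorm_extendOfNorm_le UniformSpace.Completion.denseRange_coe hC
    (norm_algebraicLift_le_coe hC hβ)

end Lift

theorem opNorm_le_of_mk {g : ProjectiveTensorProduct 𝕜 X Y →L[𝕜] 𝕜} {C : ℝ} (hC : 0 ≤ C)
    (hg : ∀ x y, ‖g (mk x y)‖ ≤ C * (‖x‖ * ‖y‖)) : ‖g‖ ≤ C := by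
  have : g = lift ((ContinuousLinearMap.compL 𝕜 Y _ 𝕜 g).comp mk) :=
    hom_ext fun x y => by rw [lift_mk]; rfl
  rw [this]
  exact norm_lift_le hC hg

/-- The tensor product of two continuous operators. -/
noncomputable def map (P : X →L[𝕜] X) (Q : Y →L[𝕜] Y) :
    ProjectiveTensorProduct 𝕜 X Y →L[𝕜] ProjectiveTensorProduct 𝕜 X Y :=
  lift (mk.bilinearComp P Q)

@[simp]
theorem map_mk (P : X →L[𝕜] X) (Q : Y →L[𝕜] Y) (x : X) (y : Y) :
    map P Q (mk x y) = mk (P x) (Q y) :=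
  lift_mk _ x y

theorem norm_map_le (P : X →L[𝕜] X) (Q : Y →L[𝕜] Y) : ‖map P Q‖ ≤ ‖P‖ * ‖Q‖ := by
  refine norm_lift_le (by positivity) fun x y => (norm_mk_le _ _).trans ?_
  calc ‖P x‖ * ‖Q y‖ ≤ (‖P‖ * ‖x‖) * (‖Q‖ * ‖y‖) := by
        gcongr <;> exact ContinuousLinearMap.le_opNorm _ _
    _ = _ := by ring

theorem tendsto_bilinear {α : Type*} {l : Filter α} (β : X →L[𝕜] Y →L[𝕜] W) {u : α → X}
    {v : α → Y} {x : X} {y : Y} (hu : Tendsto u l (𝓝 x)) (hv : Tendsto v l (𝓝 y)) :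
    Tendsto (fun a => β (u a) (v a)) l (𝓝 (β x y)) := by
  have h : Tendsto (fun a => β (u a)) l (𝓝 (β x)) := (β.continuous.tendsto x).comp hu
  exact (isBoundedBilinearMap_apply.continuous.tendsto (β x, y)).comp (h.prodMk_nhds hv)

theorem tendsto_mk {α : Type*} {l : Filter α} {u : α → X} {v : α → Y} {x : X} {y : Y}
    (hu : Tendsto u l (𝓝 x)) (hv : Tendsto v l (𝓝 y)) :
    Tendsto (fun a => mk (𝕜 := 𝕜) (u a) (v a)) l (𝓝 (mk x y)) := by
  generalize (mk : X →L[𝕜] Y →L[𝕜] ProjectiveTensorProduct 𝕜 X Y) = β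
  exact tendsto_bilinear β hu hv

/-- Tensor products of uniformly bounded, strongly convergent nets of operators converge
strongly. -/
theorem tendsto_map {α : Type*} {l : Filter α} {P : α → X →L[𝕜] X} {Q : α → Y →L[𝕜] Y}
    {P₀ : X →L[𝕜] X} {Q₀ : Y →L[𝕜] Y} {M N : ℝ} (hM : ∀ a, ‖P a‖ ≤ M) (hN : ∀ a, ‖Q a‖ ≤ N)
    (hP : ∀ x, Tendsto (fun a => P a x) l (𝓝 (P₀ x)))
    (hQ : ∀ y, Tendsto (fun a => Q a y) l (𝓝 (Q₀ y))) (z : ProjectiveTensorProduct 𝕜 X Y) :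
    Tendsto (fun a => map (P a) (Q a) z) l (𝓝 (map P₀ Q₀ z)) := by
  induction z using induction_closed with
  | hc =>
    -- The common Lipschitz constant MN makes the net equicontinuous, so its set of convergence is
    -- closed.
    refine Equicontinuous.isClosed_setOfPred_tendsto (F := fun a => ⇑(map (P a) (Q a)))
      (UniformEquicontinuous.equicontinuous (LipschitzWith.uniformEquicontinuous _
        (M * N).toNNReal fun a => ?_)) (map P₀ Q₀).continuous
    refine (map (P a) (Q a)).lipschitz.weaken ?_
    rw [← NNReal.coe_le_coe, coe_nnnorm]
    refine ((norm_map_le _ _).trans ?_).trans (Real.le_coe_toNNReal _)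
    exact mul_le_mul (hM a) (hN a) (norm_nonneg _) ((norm_nonneg _).trans (hM a))
  | hmk x y =>
    rw [map_mk]
    exact (tendsto_mk (hP x) (hQ y)).congr fun a => (map_mk _ _ x y).symm
  | hadd z w hz hw =>
    simp only [map_add]
    exact hz.add hw

end ProjectiveTensorProduct

/-! ### Scalar tools: Hölder's inequality and Phillips' lemma. -/

/-- Hölder's inequality for exponents with `1 ≤ 1 / p + 1 / q`. -/
theorem sum_mul_le_rpow_mul_rpow {α : Type*} (s : Finset α) {a b : α → ℝ} (ha : ∀ i, 0 ≤ a i)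
    (hb : ∀ i, 0 ≤ b i) {p q : ℝ} (hp : 1 < p) (hq : 1 < q) (hpq : 1 ≤ 1 / p + 1 / q) :
    ∑ i ∈ s, a i * b i ≤ (∑ i ∈ s, a i ^ p) ^ (1 / p) * (∑ i ∈ s, b i ^ q) ^ (1 / q) := by
  have hconj := Real.HolderConjugate.conjExponent hp
  set r := p.conjExponent
  have hr : 0 < r := hconj.symm.pos
  have hq0 : 0 < q := by linarith
  -- Since q ≤ r, the ℓ^r norm of b is at most its ℓ^q norm `t`, because b_i ≤ t gives b_i^r ≤ b_i^q
  -- t^(r - q).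
  have hqr : q ≤ r := by
    have h := hconj.inv_add_inv_eq_one
    rw [one_div, one_div] at hpq
    exact (inv_le_inv₀ hr hq0).mp (by linarith)
  refine (Real.inner_le_Lp_mul_Lq_of_nonneg s hconj (fun i _ => ha i) fun i _ => hb i).trans ?_
  refine mul_le_mul_of_nonneg_left ?_
    (Real.rpow_nonneg (Finset.sum_nonneg fun i _ => Real.rpow_nonneg (ha i) p) _)
  have hS : 0 ≤ ∑ i ∈ s, b i ^ q := Finset.sum_nonneg fun i _ => Real.rpow_nonneg (hb i) q
  set t := (∑ i ∈ s, b i ^ q) ^ (1 / q) with ht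
  have ht0 : 0 ≤ t := Real.rpow_nonneg hS _
  have htq : t ^ q = ∑ i ∈ s, b i ^ q := by
    rw [ht, ← Real.rpow_mul hS, one_div_mul_cancel hq0.ne', Real.rpow_one]
  have hbt : ∀ i ∈ s, b i ≤ t := fun i hi => by
    rw [← Real.rpow_le_rpow_iff (hb i) ht0 hq0, htq]
    exact Finset.single_le_sum (f := fun i => b i ^ q)
      (fun i _ => Real.rpow_nonneg (hb i) q) hi
  have hle : ∑ i ∈ s, b i ^ r ≤ t ^ r := by
    calc ∑ i ∈ s, b i ^ r ≤ ∑ i ∈ s, b i ^ q * t ^ (r - q) := by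
          refine Finset.sum_le_sum fun i hi => ?_
          rw [show r = q + (r - q) by ring, Real.rpow_add_of_nonneg (hb i) hq0.le (by linarith),
            add_sub_cancel_left]
          exact mul_le_mul_of_nonneg_left
            (Real.rpow_le_rpow (hb i) (hbt i hi) (by linarith)) (Real.rpow_nonneg (hb i) q)
      _ = t ^ r := by
          rw [← Finset.sum_mul, ← htq, ← Real.rpow_add_of_nonneg ht0 hq0.le (by linarith)]
          congr 1; ring
  calc (∑ i ∈ s, b i ^ r) ^ (1 / r) ≤ (t ^ r) ^ (1 / r) :=
        Real.rpow_le_rpow (Finset.sum_nonneg fun i _ => Real.rpow_nonneg (hb i) r) hle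
          (by positivity)
    _ = t := by rw [← Real.rpow_mul ht0, mul_one_div_cancel hr.ne', Real.rpow_one]

/-- Phillips' lemma: if the sums of all subseries of summable sequences `a n` converge as
`n → ∞`, then the entries `a n k` tend to zero uniformly in `n`. -/
theorem exists_forall_norm_lt_of_cauchySeq_subseries {𝕜 : Type*} [RCLike 𝕜] {a : ℕ → ℕ → 𝕜}
    (ha : ∀ n, Summable fun k => ‖a n k‖)
    (hc : ∀ s : ℕ → Bool, CauchySeq fun n => ∑' k, if s k then a n k else 0)
    {ε : ℝ} (hε : 0 < ε) : ∃ K, ∀ k ≥ K, ∀ n, ‖a n k‖ < ε := by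
  set F : ℕ → (ℕ → Bool) → 𝕜 := fun n s => ∑' k, if s k then a n k else 0 with hF
  have hle : ∀ n k (s : ℕ → Bool), ‖if s k then a n k else 0‖ ≤ ‖a n k‖ := fun n k s => by
    split_ifs <;> simp
  have hcont : ∀ n, Continuous (F n) := fun n => by
    refine continuous_tsum (fun k => ?_) (ha n) fun k s => hle n k s
    exact (continuous_of_discreteTopology (f := fun b : Bool => if b then a n k else 0)).comp
      (continuous_apply k)
  have hsum : ∀ n (s : ℕ → Bool), Summable fun k => if s k then a n k else 0 := fun n s =>
    Summable.of_norm_bounded (ha n) fun k => hle n k s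
  -- Baire category on the Cantor space: these closed sets cover it, so one of them contains a
  -- cylinder constraining only a finite set `I` of coordinates.
  set A : ℕ → Set (ℕ → Bool) := fun N => {s | ∀ n ≥ N, ‖F n s - F N s‖ ≤ ε / 6} with hA
  have hAc : ∀ N, IsClosed (A N) := fun N => by
    simp only [hA, Set.ofPred_forall]
    exact isClosed_iInter fun n => isClosed_iInter fun _ =>
      isClosed_le ((hcont n).sub (hcont N)).norm continuous_const
  have hAu : ⋃ N, A N = Set.univ := by
    refine Set.eq_univ_of_forall fun s => Set.mem_iUnion.2 ?_
    obtain ⟨N, hN⟩ := Metric.cauchySeq_iff'.1 (hc s) (ε / 6) (by positivity)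
    exact ⟨N, fun n hn => by simpa [dist_eq_norm] using (hN n hn).le⟩
  obtain ⟨N, s₀, hs₀⟩ := nonempty_interior_of_iUnion_of_closed hAc hAu
  obtain ⟨I, u, hu, hIu⟩ := isOpen_pi_iff.1 isOpen_interior s₀ hs₀
  have hmem : ∀ s : ℕ → Bool, (∀ i ∈ I, s i = s₀ i) → s ∈ A N := fun s hs =>
    interior_subset (hIu fun i hi => by rw [hs i hi]; exact (hu i hi).2)
  -- Toggling a coordinate k outside `I` stays in the cylinder and changes `F n` by exactly `a n k`.
  have hdiff : ∀ k ∉ I, ∀ n ≥ N, ‖a n k - a N k‖ ≤ ε / 3 := fun k hk n hn => by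
    have hne : ∀ i ∈ I, i ≠ k := fun i hi h => hk (h ▸ hi)
    have h1 := hmem (Function.update s₀ k true)
      (fun i hi => Function.update_of_ne (hne i hi) _ _) n hn
    have h0 := hmem (Function.update s₀ k false)
      (fun i hi => Function.update_of_ne (hne i hi) _ _) n hn
    have key : ∀ m, F m (Function.update s₀ k true) - F m (Function.update s₀ k false) = a m k :=
      fun m => by
        rw [hF]
        dsimp only
        rw [← (hsum m _).tsum_sub (hsum m _), tsum_eq_single k]
        · simp
        · intro j hj
          simp [Function.update_of_ne hj]
    rw [← key n, ← key N]
    calc _ = ‖(F n (Function.update s₀ k true) - F N (Function.update s₀ k true)) -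
          (F n (Function.update s₀ k false) - F N (Function.update s₀ k false))‖ := by
          congr 1; ring
      _ ≤ ε / 6 + ε / 6 := (norm_sub_le _ _).trans (add_le_add h1 h0)
      _ = ε / 3 := by ring
  have hsmall : ∀ n, ∀ᶠ k in atTop, ‖a n k‖ < ε / 2 := fun n =>
    (ha n).tendsto_atTop_zero.eventually_lt_const (by positivity)
  have hI : ∀ᶠ k in atTop, k ∉ I := by
    rw [← Nat.cofinite_eq_atTop]
    exact I.finite_toSet.eventually_cofinite_notMem
  -- The range includes row N itself, with which all later rows are compared: ε/2 + ε/3 < ε.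
  have hfin : ∀ᶠ k in atTop, ∀ n ∈ Finset.range (N + 1), ‖a n k‖ < ε / 2 :=
    (Filter.eventually_all_finset _).2 fun n _ => hsmall n
  obtain ⟨K, hK⟩ := eventually_atTop.1 (hI.and hfin)
  refine ⟨K, fun k hk n => ?_⟩
  obtain ⟨hkI, hkN⟩ := hK k hk
  rcases le_or_gt N n with hn | hn
  · have h1 := hkN N (by simp)
    have h2 := hdiff k hkI n hn
    have h3 := norm_le_norm_add_norm_sub' (a n k) (a N k)
    linarith
  · have := hkN n (by simp; omega)
    linarith

/-! ### Weakly Cauchy sequences. -/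

section Weak

variable {𝕜 Z : Type*} [RCLike 𝕜] [NormedAddCommGroup Z] [NormedSpace 𝕜 Z]

/-- If operators `T k` satisfy an `ℓ¹`-estimate, then they tend to zero uniformly along a weakly
Cauchy sequence. -/
theorem exists_norm_lt_of_weakCauchy {T : ℕ → Z →L[𝕜] Z} {C : ℝ}
    (hT : ∀ (r : ℕ) (z : Z), ∑ k ∈ Finset.range r, ‖T k z‖ ≤ C * ‖z‖) {z : ℕ → Z}
    (hz : ∀ f : StrongDual 𝕜 Z, CauchySeq fun n => f (z n)) (m : ℕ → ℕ) {ε : ℝ} (hε : 0 < ε) :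
    ∃ k, ‖T k (z (m k))‖ < ε := by
  choose φ hφ hφm using fun k => exists_dual_vector'' 𝕜 (T k (z (m k)))
  have hφle : ∀ k w, ‖φ k (T k w)‖ ≤ ‖T k w‖ := fun k w =>
    ((φ k).le_of_opNorm_le (hφ k) _).trans_eq (one_mul _)
  have hTs : ∀ w, Summable fun k => ‖T k w‖ := fun w =>
    summable_of_sum_range_le (fun _ => norm_nonneg _) fun r => hT r w
  have hTt : ∀ w, ∑' k, ‖T k w‖ ≤ C * ‖w‖ := fun w =>
    Real.tsum_le_of_sum_range_le (fun _ => norm_nonneg _) fun r => hT r w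
  have hle : ∀ (s : ℕ → Bool) k w, ‖if s k then φ k (T k w) else 0‖ ≤ ‖T k w‖ := fun s k w => by
    split_ifs
    · exact hφle k w
    · simp
  have hsum : ∀ (s : ℕ → Bool) w, Summable fun k => if s k then φ k (T k w) else 0 := fun s w =>
    Summable.of_norm_bounded (hTs w) fun k => hle s k w
  -- The ℓ¹-estimate makes every subseries of ∑ φ_k ∘ T_k a bounded functional, so weak Cauchyness
  -- supplies the hypothesis of Phillips' lemma.
  let ψ : (ℕ → Bool) → StrongDual 𝕜 Z := fun s =>
    LinearMap.mkContinuous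
      { toFun := fun w => ∑' k, if s k then φ k (T k w) else 0
        map_add' := fun v w => by
          rw [← (hsum s v).tsum_add (hsum s w)]
          refine tsum_congr fun k => ?_
          split_ifs <;> simp
        map_smul' := fun c w => by
          rw [RingHom.id_apply, smul_eq_mul, ← tsum_mul_left]
          refine tsum_congr fun k => ?_
          split_ifs <;> simp }
      C fun w => (tsum_of_norm_bounded (hTs w).hasSum fun k => hle s k w).trans (hTt w)
  obtain ⟨K, hK⟩ := exists_forall_norm_lt_of_cauchySeq_subseries
    (a := fun n k => φ k (T k (z n)))
    (fun n => Summable.of_nonneg_of_le (fun _ => norm_nonneg _) (fun k => hφle k _) (hTs (z n)))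
    (fun s => hz (ψ s)) hε
  refine ⟨K, ?_⟩
  -- Uniformity in n permits n = m K, where φ_K is norming.
  have h := hK K le_rfl (m K)
  rwa [hφm, RCLike.norm_ofReal, abs_norm] at h

/-- A sequence that is weakly Cauchy and uniformly approximable by weakly convergent sequences is
weakly convergent. -/
theorem exists_weakLimit_of_approx [CompleteSpace Z] {z : ℕ → Z}
    (hz : ∀ f : StrongDual 𝕜 Z, CauchySeq fun n => f (z n))
    (happ : ∀ ε : ℝ, 0 < ε → ∃ (w : ℕ → Z) (a : Z), (∀ n, ‖z n - w n‖ ≤ ε) ∧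
      ∀ f : StrongDual 𝕜 Z, Tendsto (fun n => f (w n)) atTop (𝓝 (f a))) :
    ∃ a : Z, ∀ f : StrongDual 𝕜 Z, Tendsto (fun n => f (z n)) atTop (𝓝 (f a)) := by
  choose ℓ hℓ using fun f => cauchySeq_tendsto_of_complete (hz f)
  -- Seen in the bidual, the limit functional `ℓ` is within every ε of Z, and Z is closed there
  -- because it is complete.
  have happ' : ∀ ε : ℝ, 0 < ε → ∃ a : Z, ∀ f : StrongDual 𝕜 Z, ‖ℓ f - f a‖ ≤ ‖f‖ * ε := by
    intro ε hε
    obtain ⟨w, a, hw, ha⟩ := happ ε hε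
    refine ⟨a, fun f => le_of_tendsto ((hℓ f).sub (ha f)).norm (Eventually.of_forall fun n => ?_)⟩
    rw [← map_sub]
    exact f.le_opNorm_of_le (hw n)
  choose a ha using fun m : ℕ => happ' ((1 / 2 : ℝ) ^ m) (by positivity)
  have hdist : ∀ m l, dist (a m) (a l) ≤ (1 / 2 : ℝ) ^ m + (1 / 2 : ℝ) ^ l := fun m l => by
    obtain ⟨f, hf, hfa⟩ := exists_dual_vector'' 𝕜 (a m - a l)
    rw [dist_eq_norm]
    calc ‖a m - a l‖ = ‖f (a m - a l)‖ := by rw [hfa, RCLike.norm_ofReal, abs_norm]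
      _ = ‖(ℓ f - f (a l)) - (ℓ f - f (a m))‖ := by rw [map_sub]; congr 1; ring
      _ ≤ ‖f‖ * (1 / 2 : ℝ) ^ l + ‖f‖ * (1 / 2 : ℝ) ^ m :=
        (norm_sub_le _ _).trans (add_le_add (ha l f) (ha m f))
      _ ≤ 1 * (1 / 2 : ℝ) ^ l + 1 * (1 / 2 : ℝ) ^ m := by gcongr
      _ = _ := by ring
  have hpow : Tendsto (fun m : ℕ => (1 / 2 : ℝ) ^ m) atTop (𝓝 0) :=
    tendsto_pow_atTop_nhds_zero_of_lt_one (by norm_num) (by norm_num)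
  have hcau : CauchySeq a := by
    refine cauchySeq_of_le_tendsto_0 (fun m => (1 / 2 : ℝ) ^ m + (1 / 2 : ℝ) ^ m)
      (fun m l N hm hl => (hdist m l).trans (add_le_add ?_ ?_)) (by simpa using hpow.add hpow)
    · exact pow_le_pow_of_le_one (by norm_num) (by norm_num) hm
    · exact pow_le_pow_of_le_one (by norm_num) (by norm_num) hl
  obtain ⟨b, hb⟩ := cauchySeq_tendsto_of_complete hcau
  refine ⟨b, fun f => ?_⟩
  have h1 : Tendsto (fun m => f (a m)) atTop (𝓝 (ℓ f)) := by
    rw [tendsto_iff_norm_sub_tendsto_zero]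
    refine squeeze_zero (fun _ => norm_nonneg _)
      (fun m => (norm_sub_rev _ _).trans_le (ha m f)) ?_
    simpa using hpow.const_mul ‖f‖
  rw [← tendsto_nhds_unique h1 ((f.continuous.tendsto b).comp hb)]
  exact hℓ f

end Weak

/-! ### Partial-sum projections of a decomposition. -/

namespace IsUnconditionalSchauderDecomposition

variable {𝕜 X ι : Type*} [RCLike 𝕜] [NormedAddCommGroup X] [NormedSpace 𝕜 X]
  {E : ι → Submodule 𝕜 X} (h : IsUnconditionalSchauderDecomposition E)

theorem hasSum_component (x : X) : HasSum (fun i => (h.component i x : X)) x :=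
  (h.existsUnique_expansion x).choose_spec.1

theorem component_eq {x : X} {u : ∀ i, E i} (hu : HasSum (fun i => (u i : X)) x) (i : ι) :
    h.component i x = u i :=
  (congrFun ((h.existsUnique_expansion x).choose_spec.2 u hu) i).symm

theorem component_add (i : ι) (x y : X) :
    h.component i (x + y) = h.component i x + h.component i y :=
  h.component_eq (u := fun i => h.component i x + h.component i y)
    (by simpa using (h.hasSum_component x).add (h.hasSum_component y)) i

theorem component_smul (i : ι) (c : 𝕜) (x : X) :
    h.component i (c • x) = c • h.component i x :=
  h.component_eq (u := fun i => c • h.component i x)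
    (by simpa using (h.hasSum_component x).const_smul c) i

/-- The projection `P_C` as a continuous linear map. -/
noncomputable def projL {c : ℝ} (hc : ∀ C x, ‖h.proj C x‖ ≤ c * ‖x‖) (C : Finset ι) : X →L[𝕜] X :=
  LinearMap.mkContinuous
    { toFun := h.proj C
      map_add' := fun x y => by
        simp [proj, component_add, Finset.sum_add_distrib]
      map_smul' := fun a x => by
        simp [proj, component_smul, Finset.smul_sum] }
    c (hc C)

variable {h}

@[simp]
theorem projL_apply {c : ℝ} (hc : ∀ C x, ‖h.proj C x‖ ≤ c * ‖x‖) (C : Finset ι) (x : X) :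
    h.projL hc C x = h.proj C x := rfl

theorem norm_projL_le {c : ℝ} (hc0 : 0 ≤ c) (hc : ∀ C x, ‖h.proj C x‖ ≤ c * ‖x‖) (C : Finset ι) :
    ‖h.projL hc C‖ ≤ c :=
  LinearMap.mkContinuous_norm_le _ hc0 _

theorem projL_sdiff [DecidableEq ι] {c : ℝ} (hc : ∀ C x, ‖h.proj C x‖ ≤ c * ‖x‖)
    {A C : Finset ι} (hAC : A ⊆ C) : h.projL hc (C \ A) = h.projL hc C - h.projL hc A := by
  ext x
  simp only [projL_apply, sub_apply]
  exact eq_sub_of_add_eq (Finset.sum_sdiff hAC)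

theorem tendsto_projL {c : ℝ} (hc : ∀ C x, ‖h.proj C x‖ ≤ c * ‖x‖) (x : X) :
    Tendsto (fun C => h.projL hc C x) atTop (𝓝 x) :=
  h.hasSum_component x

theorem finiteDimensional_range_projL {c : ℝ} (hc : ∀ C x, ‖h.proj C x‖ ≤ c * ‖x‖)
    (hfin : ∀ i, FiniteDimensional 𝕜 (E i)) (C : Finset ι) :
    FiniteDimensional 𝕜 (h.projL hc C).range := by
  have : FiniteDimensional 𝕜 (⨆ i ∈ C, E i : Submodule 𝕜 X) := by
    rw [← Finset.sup_eq_iSup]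
    exact Submodule.finiteDimensional_finset_sup C E
  refine Submodule.finiteDimensional_of_le (S₂ := ⨆ i ∈ C, E i) ?_
  rintro _ ⟨x, rfl⟩
  exact Submodule.sum_mem _ fun i hi => Submodule.mem_iSup_of_mem i
    (Submodule.mem_iSup_of_mem hi (h.component i x).2)

/-- A disjoint lower estimate bounds the projections `P_C` uniformly. -/
theorem norm_proj_le_of_lowerEstimate {p c : ℝ} (hp : 0 < p)
    (hc : ∀ (r : ℕ) (C : Fin r → Finset ι), (∀ k l, k ≠ l → Disjoint (C k) (C l)) →
      ∀ x : X, (∑ k, ‖h.proj (C k) x‖ ^ p) ^ (1 / p) ≤ c * ‖x‖) (C : Finset ι) (x : X) :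
    ‖h.proj C x‖ ≤ c * ‖x‖ := by
  have h1 := hc 1 (fun _ => C) (fun k l hkl => absurd (Subsingleton.elim k l) hkl) x
  rwa [Fin.sum_univ_one, ← Real.rpow_mul (norm_nonneg _), mul_one_div_cancel hp.ne',
    Real.rpow_one] at h1

end IsUnconditionalSchauderDecomposition

/-! ### ℓ¹-estimates by duality, and operators with a finite-rank factor. -/

namespace ProjectiveTensorProduct

variable {𝕜 X Y : Type*} [RCLike 𝕜] [NormedAddCommGroup X] [NormedSpace 𝕜 X]
  [NormedAddCommGroup Y] [NormedSpace 𝕜 Y]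

theorem map_sub_left (P P' : X →L[𝕜] X) (Q : Y →L[𝕜] Y) :
    map (P - P') Q = map P Q - map P' Q :=
  hom_ext fun x y => by simp

theorem map_sub_right (P : X →L[𝕜] X) (Q Q' : Y →L[𝕜] Y) :
    map P (Q - Q') = map P Q - map P Q' :=
  hom_ext fun x y => by simp

@[simp]
theorem map_one_one : map (1 : X →L[𝕜] X) (1 : Y →L[𝕜] Y) = 1 :=
  hom_ext fun x y => by simp

/-- A pointwise `ℓ¹`-estimate on elementary tensors extends to the tensor product. -/
theorem sum_norm_map_le {α : Type*} (s : Finset α) {P : α → X →L[𝕜] X} {Q : α → Y →L[𝕜] Y} {C : ℝ}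
    (hC : 0 ≤ C) (hPQ : ∀ x y, ∑ k ∈ s, ‖P k x‖ * ‖Q k y‖ ≤ C * (‖x‖ * ‖y‖))
    (z : ProjectiveTensorProduct 𝕜 X Y) : ∑ k ∈ s, ‖map (P k) (Q k) z‖ ≤ C * ‖z‖ := by
  choose φ hφ hφz using fun k => exists_dual_vector'' 𝕜 (map (P k) (Q k) z)
  -- With φ_k norming at z, this single functional takes the value ∑ ‖(P_k ⊗ Q_k) z‖ at z, while its
  -- norm is tested on elementary tensors only.
  have hg : ‖∑ k ∈ s, (φ k).comp (map (P k) (Q k))‖ ≤ C := opNorm_le_of_mk hC fun x y => by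
    rw [sum_apply]
    refine (norm_sum_le _ _).trans ((Finset.sum_le_sum fun k _ => ?_).trans (hPQ x y))
    rw [ContinuousLinearMap.comp_apply, map_mk]
    exact (((φ k).le_of_opNorm_le (hφ k) _).trans_eq (one_mul _)).trans (norm_mk_le _ _)
  have h := ContinuousLinearMap.le_of_opNorm_le _ hg z
  rw [sum_apply] at h
  simp only [ContinuousLinearMap.comp_apply, hφz] at h
  rwa [← RCLike.ofReal_sum, RCLike.norm_ofReal,
    abs_of_nonneg (Finset.sum_nonneg fun _ _ => norm_nonneg _)] at h

theorem exists_finiteRank_eq_sum {X : Type*} [NormedAddCommGroup X] [NormedSpace 𝕜 X]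
    (P : X →L[𝕜] X) [FiniteDimensional 𝕜 P.range] :
    ∃ (r : ℕ) (φ : Fin r → StrongDual 𝕜 X) (b : Fin r → X), ∀ x, P x = ∑ k, φ k x • b k := by
  let B := Module.finBasis 𝕜 P.range
  refine ⟨_, fun k => (LinearMap.toContinuousLinearMap (B.coord k)).comp
    (P.codRestrict P.range fun x => ⟨x, rfl⟩), fun k => B k, fun x => ?_⟩
  have h := congrArg Subtype.val (B.sum_repr ⟨P x, ⟨x, rfl⟩⟩)
  rw [AddSubmonoidClass.coe_finsetSum] at h
  exact h.symm

variable {z : ℕ → ProjectiveTensorProduct 𝕜 X Y}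

/-- If `P` has finite rank and `Y` is weakly sequentially complete, then `P ⊗ Q` maps weakly Cauchy
sequences to weakly convergent ones. -/
theorem exists_weakLimit_map_left [CompleteSpace Y] (hY : WeaklySequentiallyComplete 𝕜 Y)
    (hz : ∀ f : StrongDual 𝕜 (ProjectiveTensorProduct 𝕜 X Y), CauchySeq fun n => f (z n))
    (P : X →L[𝕜] X) [FiniteDimensional 𝕜 P.range] (Q : Y →L[𝕜] Y) :
    ∃ a, ∀ f : StrongDual 𝕜 (ProjectiveTensorProduct 𝕜 X Y),
      Tendsto (fun n => f (map P Q (z n))) atTop (𝓝 (f a)) := by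
  obtain ⟨r, φ, b, hP⟩ := exists_finiteRank_eq_sum P
  -- The slice maps x ⊗ y ↦ φ_k(x) Q y carry the weakly Cauchy sequence into Y; tensoring with b_k
  -- and summing recovers P ⊗ Q.
  let S : Fin r → ProjectiveTensorProduct 𝕜 X Y →L[𝕜] Y := fun k => lift ((φ k).smulRight Q)
  choose a ha using fun k => hY (fun n => S k (z n)) fun f => hz (f.comp (S k))
  have hmap : map P Q = ∑ k, (mk (b k)).comp (S k) := hom_ext fun x y => by
    simp [S, lift_mk, hP]
  refine ⟨∑ k, mk (b k) (a k), fun f => ?_⟩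
  simp only [hmap, sum_apply, map_sum]
  exact tendsto_finsetSum _ fun k _ => ha k (f.comp (mk (b k)))

/-- If `Q` has finite rank and `X` is weakly sequentially complete, then `P ⊗ Q` maps weakly Cauchy
sequences to weakly convergent ones. -/
theorem exists_weakLimit_map_right [CompleteSpace X] (hX : WeaklySequentiallyComplete 𝕜 X)
    (hz : ∀ f : StrongDual 𝕜 (ProjectiveTensorProduct 𝕜 X Y), CauchySeq fun n => f (z n))
    (P : X →L[𝕜] X) (Q : Y →L[𝕜] Y) [FiniteDimensional 𝕜 Q.range] :
    ∃ a, ∀ f : StrongDual 𝕜 (ProjectiveTensorProduct 𝕜 X Y),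
      Tendsto (fun n => f (map P Q (z n))) atTop (𝓝 (f a)) := by
  obtain ⟨r, φ, b, hQ⟩ := exists_finiteRank_eq_sum Q
  let T : Y →L[𝕜] X →L[𝕜] ProjectiveTensorProduct 𝕜 X Y := ContinuousLinearMap.flip mk
  let S : Fin r → ProjectiveTensorProduct 𝕜 X Y →L[𝕜] X := fun k =>
    lift ((ContinuousLinearMap.smulRightL 𝕜 Y X (φ k)).comp P)
  choose a ha using fun k => hX (fun n => S k (z n)) fun f => hz (f.comp (S k))
  have hmap : map P Q = ∑ k, (T (b k)).comp (S k) := hom_ext fun x y => by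
    simp [S, lift_mk, hQ, T]
  refine ⟨∑ k, T (b k) (a k), fun f => ?_⟩
  simp only [hmap, sum_apply, map_sum]
  exact tendsto_finsetSum _ fun k _ => ha k (f.comp (T (b k)))

end ProjectiveTensorProduct

/-! ### Block-diagonal estimate and gliding hump. -/

namespace ProjectiveTensorProduct

variable {𝕜 X Y ι κ : Type*} [RCLike 𝕜] [NormedAddCommGroup X] [NormedSpace 𝕜 X]
  [NormedAddCommGroup Y] [NormedSpace 𝕜 Y] {E : ι → Submodule 𝕜 X} {F : κ → Submodule 𝕜 Y}
  {hE : IsUnconditionalSchauderDecomposition E} {hF : IsUnconditionalSchauderDecomposition F}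
  {c d : ℝ}

/-- The `ℓ¹`-estimate for block-diagonal projections of the tensor product. -/
theorem sum_norm_map_projL_le {p q : ℝ} (hp : 1 < p) (hq : 1 < q) (hpq : 1 ≤ 1 / p + 1 / q)
    (hc0 : 0 ≤ c) (hd0 : 0 ≤ d)
    (hc : ∀ (r : ℕ) (C : Fin r → Finset ι), (∀ k l, k ≠ l → Disjoint (C k) (C l)) →
      ∀ x : X, (∑ k, ‖hE.proj (C k) x‖ ^ p) ^ (1 / p) ≤ c * ‖x‖)
    (hd : ∀ (r : ℕ) (C : Fin r → Finset κ), (∀ k l, k ≠ l → Disjoint (C k) (C l)) →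
      ∀ y : Y, (∑ k, ‖hF.proj (C k) y‖ ^ q) ^ (1 / q) ≤ d * ‖y‖)
    (hc' : ∀ C x, ‖hE.proj C x‖ ≤ c * ‖x‖) (hd' : ∀ C y, ‖hF.proj C y‖ ≤ d * ‖y‖)
    {A : ℕ → Finset ι} {B : ℕ → Finset κ} (hA : ∀ k l, k ≠ l → Disjoint (A k) (A l))
    (hB : ∀ k l, k ≠ l → Disjoint (B k) (B l)) (r : ℕ) (z : ProjectiveTensorProduct 𝕜 X Y) :
    ∑ k ∈ Finset.range r, ‖map (hE.projL hc' (A k)) (hF.projL hd' (B k)) z‖ ≤ c * d * ‖z‖ := by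
  refine sum_norm_map_le _ (mul_nonneg hc0 hd0) (fun x y => ?_) z
  rw [Finset.sum_range]
  refine (sum_mul_le_rpow_mul_rpow Finset.univ (fun k => norm_nonneg _)
    (fun k => norm_nonneg _) hp hq hpq).trans ?_
  calc _ ≤ (c * ‖x‖) * (d * ‖y‖) :=
        mul_le_mul
          (hc r (fun k => A k) (fun k l hkl => hA k l fun h => hkl (Fin.ext h)) x)
          (hd r (fun k => B k) (fun k l hkl => hB k l fun h => hkl (Fin.ext h)) y)
          (Real.rpow_nonneg (Finset.sum_nonneg fun _ _ => Real.rpow_nonneg (norm_nonneg _) _) _)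
          (by positivity)
    _ = _ := by ring

/-- A large tail of a tensor contains a large finite block. -/
theorem exists_block_of_lt_norm_tail (hc0 : 0 ≤ c) (hd0 : 0 ≤ d)
    (hc : ∀ C x, ‖hE.proj C x‖ ≤ c * ‖x‖) (hd : ∀ C y, ‖hF.proj C y‖ ≤ d * ‖y‖)
    (A : Finset ι) (B : Finset κ) (z : ProjectiveTensorProduct 𝕜 X Y) {ε : ℝ}
    (h : ε < ‖map (1 - hE.projL hc A) (1 - hF.projL hd B) z‖) :
    ∃ (A' : Finset ι) (B' : Finset κ), Disjoint A A' ∧ Disjoint B B' ∧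
      ε < ‖map (hE.projL hc A') (hF.projL hd B') z‖ := by
  classical
  have hP : ∀ x, Tendsto (fun C : Finset ι × Finset κ => (hE.projL hc C.1 - hE.projL hc A) x) atTop
      (𝓝 ((1 - hE.projL hc A) x)) := fun x => by
    rw [← prod_atTop_atTop_eq]
    exact ((IsUnconditionalSchauderDecomposition.tendsto_projL hc x).comp tendsto_fst).sub_const _
  have hQ : ∀ y, Tendsto (fun C : Finset ι × Finset κ => (hF.projL hd C.2 - hF.projL hd B) y) atTop
      (𝓝 ((1 - hF.projL hd B) y)) := fun y => by
    rw [← prod_atTop_atTop_eq]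
    exact ((IsUnconditionalSchauderDecomposition.tendsto_projL hd y).comp tendsto_snd).sub_const _
  have hbE := IsUnconditionalSchauderDecomposition.norm_projL_le hc0 hc
  have hbF := IsUnconditionalSchauderDecomposition.norm_projL_le hd0 hd
  have hlim := tendsto_map
    (fun C : Finset ι × Finset κ => (norm_sub_le _ _).trans (add_le_add (hbE C.1) (hbE A)))
    (fun C : Finset ι × Finset κ => (norm_sub_le _ _).trans (add_le_add (hbF C.2) (hbF B)))
    hP hQ z
  -- The tail is the limit of (P_C - P_A) ⊗ (P_D - P_B); once C ⊇ A and D ⊇ B, these are the blocks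
  -- of C \ A and D \ B.
  obtain ⟨⟨C, D⟩, hCD, hAC, hBD⟩ :=
    ((hlim.norm.eventually_const_lt h).and (eventually_ge_atTop (A, B))).exists
  refine ⟨C \ A, D \ B, Finset.disjoint_sdiff, Finset.disjoint_sdiff, ?_⟩
  rwa [IsUnconditionalSchauderDecomposition.projL_sdiff hc hAC,
    IsUnconditionalSchauderDecomposition.projL_sdiff hd hBD]

/-- The tails of a weakly Cauchy sequence are uniformly small. -/
theorem exists_forall_norm_tail_le {p q : ℝ} (hp : 1 < p) (hq : 1 < q) (hpq : 1 ≤ 1 / p + 1 / q)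
    (hc0 : 0 ≤ c) (hd0 : 0 ≤ d)
    (hc : ∀ (r : ℕ) (C : Fin r → Finset ι), (∀ k l, k ≠ l → Disjoint (C k) (C l)) →
      ∀ x : X, (∑ k, ‖hE.proj (C k) x‖ ^ p) ^ (1 / p) ≤ c * ‖x‖)
    (hd : ∀ (r : ℕ) (C : Fin r → Finset κ), (∀ k l, k ≠ l → Disjoint (C k) (C l)) →
      ∀ y : Y, (∑ k, ‖hF.proj (C k) y‖ ^ q) ^ (1 / q) ≤ d * ‖y‖)
    (hc' : ∀ C x, ‖hE.proj C x‖ ≤ c * ‖x‖) (hd' : ∀ C y, ‖hF.proj C y‖ ≤ d * ‖y‖)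
    {z : ℕ → ProjectiveTensorProduct 𝕜 X Y}
    (hz : ∀ f : StrongDual 𝕜 (ProjectiveTensorProduct 𝕜 X Y), CauchySeq fun n => f (z n))
    {ε : ℝ} (hε : 0 < ε) :
    ∃ (A : Finset ι) (B : Finset κ),
      ∀ n, ‖map (1 - hE.projL hc' A) (1 - hF.projL hd' B) (z n)‖ ≤ ε := by
  classical
  by_contra! hcon
  -- Gliding hump: a large tail off the union of all earlier blocks yields a new block disjoint from
  -- them. The sequence indices `t.1` need not increase.
  obtain ⟨u, hu, hdisj⟩ := exists_seq_of_forall_finset_exists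
    (fun t : ℕ × Finset ι × Finset κ =>
      ε < ‖map (hE.projL hc' t.2.1) (hF.projL hd' t.2.2) (z t.1)‖)
    (fun t t' => Disjoint t.2.1 t'.2.1 ∧ Disjoint t.2.2 t'.2.2) (fun s _ => by
      obtain ⟨n, hn⟩ := hcon (s.biUnion fun t => t.2.1) (s.biUnion fun t => t.2.2)
      obtain ⟨A', B', hA, hB, h⟩ := exists_block_of_lt_norm_tail hc0 hd0 hc' hd' _ _ _ hn
      exact ⟨(n, A', B'), h, fun t ht =>
        ⟨(Finset.disjoint_biUnion_left _ _ _).1 hA t ht,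
          (Finset.disjoint_biUnion_left _ _ _).1 hB t ht⟩⟩)
  have hA : ∀ k l, k ≠ l → Disjoint (u k).2.1 (u l).2.1 := fun k l hkl =>
    hkl.lt_or_gt.elim (fun h => (hdisj k l h).1) fun h => (hdisj l k h).1.symm
  have hB : ∀ k l, k ≠ l → Disjoint (u k).2.2 (u l).2.2 := fun k l hkl =>
    hkl.lt_or_gt.elim (fun h => (hdisj k l h).2) fun h => (hdisj l k h).2.symm
  obtain ⟨k, hk⟩ := exists_norm_lt_of_weakCauchy
    (sum_norm_map_projL_le hp hq hpq hc0 hd0 hc hd hc' hd' hA hB) hz (fun k => (u k).1) hε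
  exact (hu k).not_gt hk

end ProjectiveTensorProduct

theorem theorem3p13 {𝕜 : Type*} [RCLike 𝕜]
    {X : Type*} [NormedAddCommGroup X] [NormedSpace 𝕜 X] [CompleteSpace X]
    {Y : Type*} [NormedAddCommGroup Y] [NormedSpace 𝕜 Y] [CompleteSpace Y]
    {ι κ : Type*} (E : ι → Submodule 𝕜 X) (F : κ → Submodule 𝕜 Y)
    (hE : IsUnconditionalSchauderDecomposition E)
    (hF : IsUnconditionalSchauderDecomposition F)
    (hEfin : ∀ i, FiniteDimensional 𝕜 (E i)) (hFfin : ∀ j, FiniteDimensional 𝕜 (F j))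
    (p q : ℝ) (hp : 1 < p) (hq : 1 < q) (hpq : 1 ≤ 1 / p + 1 / q)
    (hEp : hE.HasDisjointLowerEstimate p) (hFq : hF.HasDisjointLowerEstimate q)
    (hX : WeaklySequentiallyComplete 𝕜 X) (hY : WeaklySequentiallyComplete 𝕜 Y) :
    WeaklySequentiallyComplete 𝕜 (ProjectiveTensorProduct 𝕜 X Y) := by
  obtain ⟨c, hc0, hc⟩ := hEp
  obtain ⟨d, hd0, hd⟩ := hFq
  have hc' := IsUnconditionalSchauderDecomposition.norm_proj_le_of_lowerEstimate
    (zero_lt_one.trans hp) hc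
  have hd' := IsUnconditionalSchauderDecomposition.norm_proj_le_of_lowerEstimate
    (zero_lt_one.trans hq) hd
  intro z hz
  refine exists_weakLimit_of_approx hz fun ε hε => ?_
  obtain ⟨A, B, hAB⟩ := ProjectiveTensorProduct.exists_forall_norm_tail_le hp hq hpq hc0.le hd0.le
    hc hd hc' hd' hz hε
  set P := hE.projL hc' A
  set Q := hF.projL hd' B
  have : FiniteDimensional 𝕜 P.range :=
    IsUnconditionalSchauderDecomposition.finiteDimensional_range_projL hc' hEfin A
  have : FiniteDimensional 𝕜 Q.range :=
    IsUnconditionalSchauderDecomposition.finiteDimensional_range_projL hd' hFfin B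
  obtain ⟨a₁, h₁⟩ := ProjectiveTensorProduct.exists_weakLimit_map_left hY hz P 1
  obtain ⟨a₂, h₂⟩ := ProjectiveTensorProduct.exists_weakLimit_map_right hX hz (1 - P) Q
  refine ⟨fun n => ProjectiveTensorProduct.map P 1 (z n) +
    ProjectiveTensorProduct.map (1 - P) Q (z n), a₁ + a₂, fun n => ?_, fun f => ?_⟩
  -- The error is exactly the tail (1 - P) ⊗ (1 - Q).
  · have h : ProjectiveTensorProduct.map (1 - P) (1 - Q) (z n) =
        z n - (ProjectiveTensorProduct.map P 1 (z n) +
          ProjectiveTensorProduct.map (1 - P) Q (z n)) := by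
      rw [ProjectiveTensorProduct.map_sub_right, sub_apply,
        ProjectiveTensorProduct.map_sub_left, sub_apply,
        ProjectiveTensorProduct.map_one_one, one_apply_eq_self, sub_add_eq_sub_sub]
    rw [← h]
    exact hAB n
  · simp only [map_add]
    exact (h₁ f).add (h₂ f)
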